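/- All Hilbert spaces are finite-dimensional. A state is a positive semi-definite operator of trace at most $1$. For states $\rho,\tau$ on the same space let $\bar F(\rho,\tau)=\|\sqrt\rho\sqrt\tau\|_1+\sqrt{(1-\operatorname{tr}\rho)(1-\operatorname{tr}\tau)}$ be the generalized fidelity and $P(\rho,\tau)=\sqrt{1-\bar F(\rho,\tau)^2}$ the purified distance. For a state $\rho_{AB}$ and $\varepsilon\ge 0$ define, with values in $[-\infty,\infty]$, $$H_{\min}(A|B)_\rho=\sup_{\sigma_B}\sup\{\lambda\in\mathbb R: 2^{-\lambda}\,1_A\otimes\sigma_B\ge\rho_{AB}\},\qquad H_{\min}^{\varepsilon}(A|B)_\rho=\sup_{\tilde\rho_{AB}:\,P(\rho,\tilde\rho)\le\varepsilon}H_{\min}(A|B)_{\tilde\rho},$$ where $\sigma_B$ and $\tilde\rho_{AB}$ range over states, and $H_{\max}^{\varepsilon}(A|B)_\rho=-H_{\min}^{\varepsilon}(A|C)_\rho$ for any purification $\rho_{ABC}$ of $\rho_{AB}$ (the value does not depend on the purification). Theorem. Let $\rho_{ABC}$ be a state on $A\otimes B\otimes C$, let $\mathbb X=\{M_x\}$ and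 $\mathbb Z=\{N_z\}$ be two POVMs on $A$ with finitely many outcomes, and let $\varepsilon\ge 0$. Put $$\rho_{XB}=\sum_x|x\rangle\langle x|\otimes\operatorname{tr}_{AC}(M_x\rho_{ABC}),\qquad \rho_{ZC}=\sum_z|z\rangle\langle z|\otimes\operatorname{tr}_{AB}(N_z\rho_{ABC}),$$ and $q=\log_2\frac1c$ with $c=\max_{x,z}\|\sqrt{M_x}\sqrt{N_z}\|_\infty^2$, where $\|\cdot\|_\infty$ is the largest singular value. Then $$H_{\min}^{\varepsilon}(X|B)_\rho+H_{\max}^{\varepsilon}(Z|C)_\rho\ \ge\ q\qquad\text{if }\varepsilon<\sqrt{\operatorname{tr}\rho_{ABC}},$$ and, for every $\varepsilon\ge 0$, $H_{\min}^{\varepsilon}(X|B)_\rho\ \ge\ q-H_{\max}^{\varepsilon}(Z|C)_\rho$. (If $\varepsilon\ge\sqrt{\operatorname{tr}\rho_{ABC}}$, then $H_{\min}^{\varepsilon}(X|B)_\rho=+\infty$ and $H_{\max}^{\varepsilon}(Z|C)_\rho=-\infty$, so that the sum is undefined.) -/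

import Mathlib

open scoped Kronecker ComplexOrder MatrixOrder Matrix.Norms.L2Operator

namespace SmoothEntropy

/-- A quantum state on the finite-dimensional Hilbert space with orthonormal basis `ι`:
a positive semi-definite operator of trace at most one. -/
def IsState {ι : Type*} [Fintype ι] (ρ : Matrix ι ι ℂ) : Prop :=
  ρ.PosSemidef ∧ ρ.trace.re ≤ 1

/-- A POVM with finitely many outcomes. -/
def IsPOVM {ι X : Type*} [Fintype ι] [DecidableEq ι] [Fintype X]
    (M : X → Matrix ι ι ℂ) : Prop :=
  (∀ x, (M x).PosSemidef) ∧ ∑ x, M x = 1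

/-- Partial trace over the first and third of three systems. -/
def trace13 {A B C : Type*} [Fintype A] [Fintype C]
    (ω : Matrix (A × B × C) (A × B × C) ℂ) : Matrix B B ℂ :=
  Matrix.of fun b b' => ∑ a, ∑ c, ω (a, b, c) (a, b', c)

/-- Partial trace over the first and second of three systems. -/
def trace12 {A B C : Type*} [Fintype A] [Fintype B]
    (ω : Matrix (A × B × C) (A × B × C) ℂ) : Matrix C C ℂ :=
  Matrix.of fun c c' => ∑ a, ∑ b, ω (a, b, c) (a, b, c')

/-- Partial trace over the second of three systems. -/
def trace2 {A B C : Type*} [Fintype B]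
    (ω : Matrix (A × B × C) (A × B × C) ℂ) : Matrix (A × C) (A × C) ℂ :=
  Matrix.of fun p p' => ∑ b, ω (p.1, b, p.2) (p'.1, b, p'.2)

/-- Partial trace over the third of three systems. -/
def trace3 {A B C : Type*} [Fintype C]
    (ω : Matrix (A × B × C) (A × B × C) ℂ) : Matrix (A × B) (A × B) ℂ :=
  Matrix.of fun p p' => ∑ c, ω (p.1, p.2, c) (p'.1, p'.2, c)

/-- The rank-one operator `|ψ⟩⟨ψ|` (zero if `ψ = 0`). -/
def pureState {ι : Type*} (ψ : ι → ℂ) : Matrix ι ι ℂ :=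
  Matrix.vecMulVec ψ (star ψ)

/-- The trace norm `tr √(T† T)`. -/
noncomputable def traceNorm {ι : Type*} [Fintype ι] [DecidableEq ι] (T : Matrix ι ι ℂ) : ℝ :=
  (CFC.sqrt (T.conjTranspose * T)).trace.re

/-- The generalized fidelity `‖√ρ √τ‖₁ + √((1 - tr ρ) (1 - tr τ))` of two states. It is the
fidelity of the normalized states `ρ ⊕ (1 - tr ρ)` and `τ ⊕ (1 - tr τ)`. -/
noncomputable def fidelity {ι : Type*} [Fintype ι] [DecidableEq ι] (ρ τ : Matrix ι ι ℂ) : ℝ :=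
  traceNorm (CFC.sqrt ρ * CFC.sqrt τ) + √((1 - ρ.trace.re) * (1 - τ.trace.re))

/-- The purified distance of two states. By Uhlmann's theorem it is the minimal trace distance
between purifications of the normalized states `ρ ⊕ (1 - tr ρ)` and `τ ⊕ (1 - tr τ)`. -/
noncomputable def purifiedDist {ι : Type*} [Fintype ι] [DecidableEq ι]
    (ρ τ : Matrix ι ι ℂ) : ℝ :=
  √(1 - fidelity ρ τ ^ 2)

/-- The conditional min-entropy `H_min(A|B)` of an operator on `A ⊗ B`, with values in the
extended reals: the supremum of all `λ` with `2^(-λ) 1 ⊗ σ ≥ ρ` for some state `σ` on `B`. -/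
noncomputable def minEntropy {A B : Type*} [Fintype A] [DecidableEq A] [Fintype B]
    (ρ : Matrix (A × B) (A × B) ℂ) : EReal :=
  ⨆ (σ : Matrix B B ℂ) (_ : IsState σ),
    ⨆ (r : ℝ) (_ : ρ ≤ (2 : ℝ) ^ (-r) • ((1 : Matrix A A ℂ) ⊗ₖ σ)), (r : EReal)

/-- The smooth conditional min-entropy: the min-entropy is maximized over all states in the
`ε`-ball of the purified distance. -/
noncomputable def smoothMinEntropy {A B : Type*} [Fintype A] [DecidableEq A] [Fintype B]
    [DecidableEq B] (ε : ℝ) (ρ : Matrix (A × B) (A × B) ℂ) : EReal :=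
  ⨆ (τ : Matrix (A × B) (A × B) ℂ) (_ : IsState τ ∧ purifiedDist ρ τ ≤ ε), minEntropy τ

/-- The smooth conditional max-entropy `H_max^ε(A|B) = - H_min^ε(A|C)`, where `C` is the purifying
system of a purification of `ρ` on `A ⊗ B ⊗ C`. All purifications give the same value; the
infimum runs over all of them, in every finite dimension of `C`. -/
noncomputable def smoothMaxEntropy {A B : Type*} [Fintype A] [DecidableEq A] [Fintype B]
    (ε : ℝ) (ρ : Matrix (A × B) (A × B) ℂ) : EReal :=
  ⨅ (n : ℕ) (ψ : A × B × Fin n → ℂ) (_ : trace3 (pureState ψ) = ρ),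
    -smoothMinEntropy ε (trace2 (pureState ψ))

/-- The state of the outcome register `X` and the system `B` after measuring `A`:
`∑ₓ |x⟩⟨x| ⊗ tr_AC (Mₓ ρ_ABC)`. -/
noncomputable def measuredB {A B C X : Type*} [Fintype A] [Fintype B] [DecidableEq B]
    [Fintype C] [DecidableEq C] [Fintype X] [DecidableEq X]
    (M : X → Matrix A A ℂ) (ρ : Matrix (A × B × C) (A × B × C) ℂ) :
    Matrix (X × B) (X × B) ℂ :=
  ∑ x, Matrix.single x x (1 : ℂ) ⊗ₖ
    trace13 ((M x ⊗ₖ (1 : Matrix (B × C) (B × C) ℂ)) * ρ)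

/-- The state of the outcome register `Z` and the system `C` after measuring `A`:
`∑_z |z⟩⟨z| ⊗ tr_AB (N_z ρ_ABC)`. -/
noncomputable def measuredC {A B C Z : Type*} [Fintype A] [Fintype B] [DecidableEq B]
    [Fintype C] [DecidableEq C] [Fintype Z] [DecidableEq Z]
    (N : Z → Matrix A A ℂ) (ρ : Matrix (A × B × C) (A × B × C) ℂ) :
    Matrix (Z × C) (Z × C) ℂ :=
  ∑ z, Matrix.single z z (1 : ℂ) ⊗ₖ
    trace12 ((N z ⊗ₖ (1 : Matrix (B × C) (B × C) ℂ)) * ρ)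

/-- The overlap `c = max_{x,z} ‖√Mₓ √N_z‖²`, in the operator norm (largest singular value). -/
noncomputable def overlap {A X Z : Type*} [Fintype A] [DecidableEq A]
    (M : X → Matrix A A ℂ) (N : Z → Matrix A A ℂ) : ℝ :=
  ⨆ p : X × Z, ‖CFC.sqrt (M p.1) * CFC.sqrt (N p.2)‖ ^ 2

/-- The incompatibility `q = log₂ (1 / c)`. -/
noncomputable def incompatibility {A X Z : Type*} [Fintype A] [DecidableEq A]
    (M : X → Matrix A A ℂ) (N : Z → Matrix A A ℂ) : ℝ :=
  Real.logb 2 (1 / overlap M N)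

end SmoothEntropy

/-! The relation is a data-processing inequality. Take a purification of `ρ_ABC` by a system `E` and
apply to it the isometry `V_N = ∑_z |z⟩|z⟩ ⊗ √N_z`. The result purifies `ρ_ZC`, with purifying
system `Z'ABE`. Any other purification `ψ_ZCD` of `ρ_ZC` is carried to this one by a contraction `W`
on `D` (`exists_contraction_of_purification`). Apply `W`, undo `V_N`, measure `M` and keep `X` and
`B`: this completely positive, trace non-increasing map sends `ψ_ZD` to `ρ_XB`.

The map does not increase the purified distance (`purifiedDist_partialTrace_le`). It sends `1_Z ⊗
σ_D` to an operator at most `c 1_X ⊗ σ'_B` for a state `σ'_B`, because `√M_x` meets `√N_z` there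
(`partialTrace_exchangeDilation_le`). So each witness `(τ, σ, r)` for the smooth min-entropy of
`ψ_ZD` yields a witness for `ρ_XB` with `r + q` in place of `r`. The infimum over purifications
gives the difference form; finiteness of the min-entropy turns it into the sum form. -/

namespace SmoothEntropy

open Matrix

/-! ### Contractions, polar decomposition and the trace norm -/

section Contractions

variable {m n k : Type*} [Fintype m] [Fintype n] [DecidableEq n]
  [Fintype k] [DecidableEq k]

/-- Functional calculus with `x⁻¹`. The convention `0⁻¹ = 0` makes both identities hold on the
kernel, and continuity is automatic on a finite spectrum. -/
theorem exists_pseudoinverse {S : Matrix n n ℂ} (hS : S.IsHermitian) :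
    ∃ R : Matrix n n ℂ, Rᴴ = R ∧ S * R * S = S ∧ R * S * R = R := by
  have hS' : IsSelfAdjoint S := hS
  have hc : ∀ f : ℝ → ℝ, ContinuousOn f (spectrum ℝ S) := fun f =>
    (Matrix.finite_real_spectrum).continuousOn f
  have hid : cfc (fun x : ℝ => x) S = S := cfc_id' ℝ S
  refine ⟨cfc (fun x : ℝ => x⁻¹) S, (IsSelfAdjoint.cfc : IsSelfAdjoint _), ?_, ?_⟩
  · have h : cfc (fun x : ℝ => x) S * cfc (fun x : ℝ => x⁻¹) S * cfc (fun x : ℝ => x) S =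
        cfc (fun x : ℝ => x) S := by
      rw [← cfc_mul _ _ S (hc _) (hc _), ← cfc_mul _ _ S (hc _) (hc _)]
      congr 1
      funext x
      exact mul_inv_mul_cancel x
    rwa [hid] at h
  · conv_lhs => enter [1, 2]; rw [← hid]
    rw [← cfc_mul _ _ S (hc _) (hc _), ← cfc_mul _ _ S (hc _) (hc _)]
    congr 1
    funext x
    simpa using mul_inv_mul_cancel x⁻¹

/-- `G` vanishes wherever its Gram matrix `S` does, and `R * S` alters vectors only by kernel
elements of `S`. -/
theorem mul_pseudoinverse_mul_cancel {S R : Matrix n n ℂ} (hR : S * R * S = S)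
    {G : Matrix m n ℂ} (hG : Gᴴ * G = S) : G * (R * S) = G := by
  have h : (G - G * (R * S))ᴴ * (G - G * (R * S)) = 0 := by
    have h1 : Gᴴ * (G - G * (R * S)) = 0 := by
      rw [Matrix.mul_sub, ← Matrix.mul_assoc, hG, ← Matrix.mul_assoc, hR, sub_self]
    rw [conjTranspose_sub, conjTranspose_mul G, Matrix.sub_mul, Matrix.mul_assoc, h1]
    simp
  exact (sub_eq_zero.mp (conjTranspose_mul_self_eq_zero.mp h)).symm

/-- Two matrices with the same Gram matrix differ by a partial isometry. -/
theorem exists_contraction_of_gram_eq {G : Matrix m n ℂ} {H : Matrix k n ℂ}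
    (h : Gᴴ * G = Hᴴ * H) :
    ∃ W : Matrix m k ℂ, ‖W‖ ≤ 1 ∧ W * H = G ∧ Wᴴ * G = H := by
  obtain ⟨R, hR, hSRS, hRSR⟩ := exists_pseudoinverse (isHermitian_conjTranspose_mul_self H)
  -- With `R` the pseudoinverse of the common Gram matrix, `Wᴴ * W = H * R * Hᴴ` is a projection,
  -- which gives the norm bound.
  refine ⟨G * R * Hᴴ, ?_, ?_, ?_⟩
  · have hW : (G * R * Hᴴ)ᴴ * (G * R * Hᴴ) = H * R * Hᴴ := by
      calc (G * R * Hᴴ)ᴴ * (G * R * Hᴴ) = H * (R * (Gᴴ * G) * R) * Hᴴ := by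
            simp only [conjTranspose_mul, conjTranspose_conjTranspose, hR, Matrix.mul_assoc]
        _ = _ := by rw [h, hRSR]
    have hp : (H * R * Hᴴ)ᴴ * (H * R * Hᴴ) = H * R * Hᴴ := by
      calc (H * R * Hᴴ)ᴴ * (H * R * Hᴴ) = H * (R * (Hᴴ * H) * R) * Hᴴ := by
            simp only [conjTranspose_mul, conjTranspose_conjTranspose, hR, Matrix.mul_assoc]
        _ = _ := by rw [hRSR]
    have h1 := l2_opNorm_conjTranspose_mul_self (G * R * Hᴴ)
    have h2 := l2_opNorm_conjTranspose_mul_self (H * R * Hᴴ)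
    rw [hW] at h1
    rw [hp] at h2
    have := norm_nonneg (G * R * Hᴴ)
    have := norm_nonneg (H * R * Hᴴ)
    have h3 : ‖H * R * Hᴴ‖ ≤ 1 := by nlinarith
    nlinarith
  · rw [Matrix.mul_assoc, Matrix.mul_assoc]
    exact mul_pseudoinverse_mul_cancel hSRS h
  · have : (G * R * Hᴴ)ᴴ * G = H * (R * (Gᴴ * G)) := by
      simp only [conjTranspose_mul, conjTranspose_conjTranspose, hR, Matrix.mul_assoc]
    rw [this, h]
    exact mul_pseudoinverse_mul_cancel hSRS rfl

theorem conjTranspose_mul_self_le_one {K : Matrix m n ℂ} (hK : ‖K‖ ≤ 1) : Kᴴ * K ≤ 1 := by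
  have h0 : 0 ≤ Kᴴ * K := (posSemidef_conjTranspose_mul_self K).nonneg
  rw [← CStarAlgebra.norm_le_one_iff_of_nonneg _ h0, l2_opNorm_conjTranspose_mul_self]
  exact mul_le_one₀ hK (norm_nonneg _) hK

theorem norm_le_one_of_conjTranspose_mul_self {K : Matrix m n ℂ} (hK : Kᴴ * K = 1) :
    ‖K‖ ≤ 1 := by
  have h1 := l2_opNorm_conjTranspose_mul_self K
  rw [hK] at h1
  -- The index type may be empty, so `‖1‖ = 1` can fail; `‖1‖ = ‖1‖²` still gives `‖1‖ ≤ 1`.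
  have h2 := l2_opNorm_conjTranspose_mul_self (1 : Matrix n n ℂ)
  simp only [conjTranspose_one, mul_one] at h2
  have := norm_nonneg K
  have := norm_nonneg (1 : Matrix n n ℂ)
  have h3 : ‖(1 : Matrix n n ℂ)‖ ≤ 1 := by nlinarith
  nlinarith

theorem norm_mul_le_one {K : Matrix m n ℂ} {L : Matrix n k ℂ} (hK : ‖K‖ ≤ 1) (hL : ‖L‖ ≤ 1) :
    ‖K * L‖ ≤ 1 :=
  (l2_opNorm_mul K L).trans (mul_le_one₀ hK (norm_nonneg _) hL)

/-- The Cauchy-Schwarz inequality for the Hilbert-Schmidt inner product. -/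
theorem re_trace_mul_conjTranspose_le {n : Type*} [Fintype n] (P Q : Matrix m n ℂ) :
    (P * Qᴴ).trace.re ≤ √((P * Pᴴ).trace.re * (Q * Qᴴ).trace.re) := by
  have key : ∀ U V : Matrix m n ℂ, (U * Vᴴ).trace =
      inner ℂ (WithLp.toLp 2 fun p : m × n => V p.1 p.2)
        (WithLp.toLp 2 fun p : m × n => U p.1 p.2) := by
    intro U V
    simp [Matrix.trace, Matrix.mul_apply, PiLp.inner_apply, Fintype.sum_prod_type]
  have h2 : ∀ U : Matrix m n ℂ, (U * Uᴴ).trace.re =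
      ‖WithLp.toLp 2 fun p : m × n => U p.1 p.2‖ ^ 2 := by
    intro U
    rw [key]
    exact inner_self_eq_norm_sq (𝕜 := ℂ) _
  rw [h2, h2, key, ← mul_pow, Real.sqrt_sq (by positivity), mul_comm]
  exact re_inner_le_norm (𝕜 := ℂ) _ _

theorem PosSemidef.exists_mul_conjTranspose {T : Matrix n n ℂ} (hT : T.PosSemidef) :
    ∃ S : Matrix n n ℂ, S * Sᴴ = T := by
  obtain ⟨S, hS⟩ := CStarAlgebra.nonneg_iff_eq_star_mul_self.mp hT.nonneg
  exact ⟨Sᴴ, by simpa [star_eq_conjTranspose] using hS.symm⟩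

theorem sqrt_conjTranspose (T : Matrix n n ℂ) : (CFC.sqrt T)ᴴ = CFC.sqrt T :=
  ((nonneg_iff_posSemidef).mp (CFC.sqrt_nonneg T)).isHermitian

theorem PosSemidef.sqrt_mul_sqrt {T : Matrix n n ℂ} (hT : T.PosSemidef) :
    CFC.sqrt T * CFC.sqrt T = T :=
  CFC.sqrt_mul_sqrt_self T hT.nonneg

theorem re_trace_le_re_trace {n : Type*} [Fintype n] {S T : Matrix n n ℂ} (h : S ≤ T) : S.trace.re ≤ T.trace.re := by
  have := ((Matrix.le_iff).mp h).trace_nonneg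
  rw [trace_sub] at this
  exact (Complex.le_def.mp (sub_nonneg.mp this)).1

/-- Cauchy-Schwarz for `L * Q` and `Q`, where `T = Q * Qᴴ`. -/
theorem re_trace_mul_le_of_posSemidef {L T : Matrix n n ℂ} (hL : ‖L‖ ≤ 1) (hT : T.PosSemidef) :
    (L * T).trace.re ≤ T.trace.re := by
  obtain ⟨Q, hQ⟩ := PosSemidef.exists_mul_conjTranspose hT
  have h1 : (L * T).trace = ((L * Q) * Qᴴ).trace := by rw [Matrix.mul_assoc, hQ]
  have h2 := re_trace_mul_conjTranspose_le (L * Q) Q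
  have h3 : ((L * Q) * (L * Q)ᴴ).trace.re ≤ T.trace.re := by
    rw [trace_mul_comm]
    have : (L * Q)ᴴ * (L * Q) ≤ Qᴴ * Q := by
      have := (conjTranspose_mul_self_le_one hL)
      rw [Matrix.le_iff] at this ⊢
      have := this.conjTranspose_mul_mul_same Q
      simpa [Matrix.mul_sub, Matrix.sub_mul, Matrix.mul_assoc] using this
    calc _ ≤ (Qᴴ * Q).trace.re := re_trace_le_re_trace this
      _ = _ := by rw [trace_mul_comm, hQ]
  rw [h1]
  refine h2.trans ?_
  rw [hQ]
  have h0 : 0 ≤ T.trace.re := (Complex.le_def.mp hT.trace_nonneg).1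
  calc _ ≤ √(T.trace.re * T.trace.re) := Real.sqrt_le_sqrt (by gcongr)
    _ = _ := Real.sqrt_mul_self h0

theorem exists_polar (T : Matrix m n ℂ) :
    ∃ W : Matrix m n ℂ, ‖W‖ ≤ 1 ∧ W * CFC.sqrt (Tᴴ * T) = T ∧ Wᴴ * T = CFC.sqrt (Tᴴ * T) := by
  apply exists_contraction_of_gram_eq
  rw [sqrt_conjTranspose, PosSemidef.sqrt_mul_sqrt (posSemidef_conjTranspose_mul_self T)]

/-- Duality of trace norm and operator norm: write `T = W |T|`; then `K * W` is again a contraction.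
-/
theorem re_trace_mul_le_traceNorm {K T : Matrix n n ℂ} (hK : ‖K‖ ≤ 1) :
    (K * T).trace.re ≤ traceNorm T := by
  obtain ⟨W, hW, hWT, -⟩ := exists_polar T
  conv_lhs => rw [← hWT, ← Matrix.mul_assoc]
  exact re_trace_mul_le_of_posSemidef (norm_mul_le_one hK hW)
    ((nonneg_iff_posSemidef).mp (CFC.sqrt_nonneg _))

theorem traceNorm_nonneg (T : Matrix n n ℂ) : 0 ≤ traceNorm T :=
  (Complex.le_def.mp ((nonneg_iff_posSemidef).mp (CFC.sqrt_nonneg (Tᴴ * T))).trace_nonneg).1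

/-- Every pair of factorizations bounds the fidelity from below. -/
theorem re_trace_mul_conjTranspose_le_traceNorm [DecidableEq m] (P Q : Matrix n m ℂ) :
    (P * Qᴴ).trace.re ≤ traceNorm (CFC.sqrt (P * Pᴴ) * CFC.sqrt (Q * Qᴴ)) := by
  have aux : ∀ U : Matrix n m ℂ, ∃ W : Matrix m n ℂ, ‖W‖ ≤ 1 ∧ W * CFC.sqrt (U * Uᴴ) = Uᴴ := by
    intro U
    obtain ⟨W, h1, h2, -⟩ := exists_polar Uᴴ
    exact ⟨W, h1, by simpa using h2⟩
  obtain ⟨W₁, hW₁, h₁⟩ := aux P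
  obtain ⟨W₂, hW₂, h₂⟩ := aux Q
  have h : (P * Qᴴ).trace.re =
      ((W₂ᴴ * W₁) * (CFC.sqrt (P * Pᴴ) * CFC.sqrt (Q * Qᴴ))).trace.re := by
    have : (Q * Pᴴ).trace = ((W₂ᴴ * W₁) * (CFC.sqrt (P * Pᴴ) * CFC.sqrt (Q * Qᴴ))).trace := by
      have h₃ : CFC.sqrt (Q * Qᴴ) * W₂ᴴ = Q := by
        rw [← sqrt_conjTranspose (Q * Qᴴ), ← conjTranspose_mul, h₂, conjTranspose_conjTranspose]
      rw [← Matrix.mul_assoc, trace_mul_comm, Matrix.mul_assoc W₂ᴴ, h₁,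
        trace_mul_comm (W₂ᴴ * Pᴴ), ← Matrix.mul_assoc, h₃, trace_mul_comm]
    rw [← this]
    have h' : (Q * Pᴴ).trace = star (P * Qᴴ).trace := by
      rw [← trace_conjTranspose]; simp
    rw [h']
    simp
  rw [h]
  exact re_trace_mul_le_traceNorm
    (norm_mul_le_one (by rwa [l2_opNorm_conjTranspose]) hW₁)

/-- Some pair of factorizations attains the fidelity. -/
theorem exists_factorization_traceNorm {ρ τ : Matrix n n ℂ} (hρ : ρ.PosSemidef)
    (hτ : τ.PosSemidef) : ∃ P Q : Matrix n (n ⊕ n) ℂ, P * Pᴴ = ρ ∧ Q * Qᴴ = τ ∧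
      (P * Qᴴ).trace.re = traceNorm (CFC.sqrt ρ * CFC.sqrt τ) := by
  obtain ⟨W, hW, -, hWT⟩ := exists_polar (CFC.sqrt ρ * CFC.sqrt τ)
  obtain ⟨S, hS⟩ := PosSemidef.exists_mul_conjTranspose ((Matrix.le_iff).mp
    (conjTranspose_mul_self_le_one (K := Wᴴ) (by rwa [l2_opNorm_conjTranspose])))
  rw [conjTranspose_conjTranspose] at hS
  -- `W` is only a contraction. The second block, with `S * Sᴴ = 1 - W * Wᴴ`, completes `√ρ W` to a
  -- factor of `ρ`; it faces a zero block, so the overlap is unchanged.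
  refine ⟨fromCols (CFC.sqrt ρ * W) (CFC.sqrt ρ * S), fromCols (CFC.sqrt τ) 0, ?_, ?_, ?_⟩
  · rw [conjTranspose_fromCols_eq_fromRows_conjTranspose, fromCols_mul_fromRows,
      conjTranspose_mul, conjTranspose_mul, sqrt_conjTranspose]
    calc _ = CFC.sqrt ρ * (W * Wᴴ + S * Sᴴ) * CFC.sqrt ρ := by
          simp only [Matrix.mul_add, Matrix.add_mul, Matrix.mul_assoc]
      _ = _ := by rw [hS, add_sub_cancel, Matrix.mul_one, PosSemidef.sqrt_mul_sqrt hρ]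
  · rw [conjTranspose_fromCols_eq_fromRows_conjTranspose, fromCols_mul_fromRows,
      sqrt_conjTranspose, PosSemidef.sqrt_mul_sqrt hτ]
    simp
  · rw [conjTranspose_fromCols_eq_fromRows_conjTranspose, fromCols_mul_fromRows,
      sqrt_conjTranspose, traceNorm, ← hWT]
    simp only [conjTranspose_zero, Matrix.mul_zero, add_zero]
    have : (Wᴴ * (CFC.sqrt ρ * CFC.sqrt τ)).trace = star (CFC.sqrt ρ * W * CFC.sqrt τ).trace := by
      rw [← trace_conjTranspose, conjTranspose_mul, conjTranspose_mul, sqrt_conjTranspose,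
        sqrt_conjTranspose, ← Matrix.mul_assoc, trace_mul_comm]
    rw [this]
    simp

end Contractions

/-! ### Partial traces and monotonicity of the generalized fidelity -/

section PartialTrace

variable {n r m k : Type*} [Fintype r] [Fintype m] [Fintype k]

/-- The partial trace over the second of two systems. -/
def partialTrace {n r : Type*} [Fintype r] (T : Matrix (n × r) (n × r) ℂ) : Matrix n n ℂ :=
  Matrix.of fun i j => ∑ l, T (i, l) (j, l)

/-- Move the second row index to the columns. -/
def reshape {n r m : Type*} (P : Matrix (n × r) m ℂ) : Matrix n (r × m) ℂ :=
  Matrix.of fun i q => P (i, q.1) q.2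

/-- A system that is traced out may be counted as purifying, so factorizations survive the partial
trace. -/
theorem reshape_mul_conjTranspose (P Q : Matrix (n × r) m ℂ) :
    reshape P * (reshape Q)ᴴ = partialTrace (P * Qᴴ) := by
  ext i j
  simp [reshape, partialTrace, Matrix.mul_apply, Fintype.sum_prod_type]

theorem partialTrace_sub (S T : Matrix (n × r) (n × r) ℂ) :
    partialTrace (S - T) = partialTrace S - partialTrace T := by
  ext i j
  simp [partialTrace]

theorem partialTrace_smul (c : ℝ) (T : Matrix (n × r) (n × r) ℂ) :
    partialTrace (c • T) = c • partialTrace T := by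
  ext i j
  simp [partialTrace, Finset.mul_sum]

variable [Fintype n]

theorem trace_partialTrace (T : Matrix (n × r) (n × r) ℂ) : (partialTrace T).trace = T.trace := by
  simp [partialTrace, Matrix.trace, Fintype.sum_prod_type]

omit [Fintype n] in
theorem partialTrace_conj_mul_conjTranspose (K : Matrix (n × r) m ℂ) (P Q : Matrix m k ℂ) :
    partialTrace (K * (P * Qᴴ) * Kᴴ) = reshape (K * P) * (reshape (K * Q))ᴴ := by
  rw [reshape_mul_conjTranspose, conjTranspose_mul]
  simp only [Matrix.mul_assoc]

variable [DecidableEq m]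

theorem posSemidef_partialTrace_conj (K : Matrix (n × r) m ℂ) {T : Matrix m m ℂ}
    (hT : T.PosSemidef) : (partialTrace (K * T * Kᴴ)).PosSemidef := by
  obtain ⟨S, rfl⟩ := PosSemidef.exists_mul_conjTranspose hT
  rw [partialTrace_conj_mul_conjTranspose]
  exact posSemidef_self_mul_conjTranspose _

theorem partialTrace_conj_mono (K : Matrix (n × r) m ℂ) {S T : Matrix m m ℂ} (h : S ≤ T) :
    partialTrace (K * S * Kᴴ) ≤ partialTrace (K * T * Kᴴ) := by
  rw [Matrix.le_iff] at h ⊢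
  rw [← partialTrace_sub, ← Matrix.sub_mul, ← Matrix.mul_sub]
  exact posSemidef_partialTrace_conj K h

/-- With `S * Sᴴ = 1 - Kᴴ * K`, stacking `K` on `Sᴴ` gives an isometry. The trace lost under `K`
thus becomes an inner product, open to Cauchy-Schwarz. -/
theorem exists_defect {K : Matrix n m ℂ} (hK : ‖K‖ ≤ 1) : ∃ S : Matrix m m ℂ,
    ∀ P Q : Matrix m k ℂ, (P * Qᴴ).trace =
      (K * (P * Qᴴ) * Kᴴ).trace + ((Sᴴ * P) * (Sᴴ * Q)ᴴ).trace := by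
  obtain ⟨S, hS⟩ := PosSemidef.exists_mul_conjTranspose
    ((Matrix.le_iff).mp (conjTranspose_mul_self_le_one hK))
  refine ⟨S, fun P Q => ?_⟩
  have h1 : (K * (P * Qᴴ) * Kᴴ).trace = ((Kᴴ * K) * (P * Qᴴ)).trace := by
    rw [trace_mul_comm, Matrix.mul_assoc]
  have h2 : ((Sᴴ * P) * (Sᴴ * Q)ᴴ).trace = ((S * Sᴴ) * (P * Qᴴ)).trace := by
    rw [conjTranspose_mul, conjTranspose_conjTranspose, ← Matrix.mul_assoc, trace_mul_comm]
    simp only [Matrix.mul_assoc]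
  rw [h1, h2, hS, ← trace_add, ← Matrix.add_mul, add_sub_cancel, Matrix.one_mul]

theorem re_trace_mul_conjTranspose_self_nonneg {m : Type*} [Fintype m] (P : Matrix n m ℂ) : 0 ≤ (P * Pᴴ).trace.re :=
  (Complex.le_def.mp (posSemidef_self_mul_conjTranspose P).trace_nonneg).1

theorem IsState.partialTrace_conj {K : Matrix (n × r) m ℂ} (hK : ‖K‖ ≤ 1) {ρ : Matrix m m ℂ}
    (hρ : IsState ρ) : IsState (partialTrace (K * ρ * Kᴴ)) := by
  refine ⟨posSemidef_partialTrace_conj K hρ.1, ?_⟩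
  obtain ⟨P, rfl⟩ := PosSemidef.exists_mul_conjTranspose hρ.1
  obtain ⟨S, hS⟩ := exists_defect (k := m) hK
  have h1 := congrArg Complex.re (hS P P)
  have h2 := re_trace_mul_conjTranspose_self_nonneg (Sᴴ * P)
  have h3 := hρ.2
  rw [Complex.add_re] at h1
  rw [trace_partialTrace]
  linarith

/-- Cauchy-Schwarz for `(√x, √u)` and `(√y, √v)`. -/
theorem sqrt_mul_add_sqrt_mul_le {x y u v : ℝ} (hx : 0 ≤ x) (hy : 0 ≤ y) (hu : 0 ≤ u)
    (hv : 0 ≤ v) : √(x * y) + √(u * v) ≤ √((x + u) * (y + v)) := by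
  apply Real.le_sqrt_of_sq_le
  rw [Real.sqrt_mul hx, Real.sqrt_mul hu]
  nlinarith [sq_nonneg (√x * √v - √u * √y), Real.sq_sqrt hx, Real.sq_sqrt hy, Real.sq_sqrt hu,
    Real.sq_sqrt hv]

variable [DecidableEq n]

/-- The generalized fidelity does not decrease under trace non-increasing completely positive
maps, given in Stinespring form. -/
theorem fidelity_le_fidelity_partialTrace [DecidableEq r] {K : Matrix (n × r) m ℂ} (hK : ‖K‖ ≤ 1)
    {ρ τ : Matrix m m ℂ} (hρ : IsState ρ) (hτ : IsState τ) :
    fidelity ρ τ ≤ fidelity (partialTrace (K * ρ * Kᴴ)) (partialTrace (K * τ * Kᴴ)) := by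
  have hρ' := hρ.partialTrace_conj hK
  have hτ' := hτ.partialTrace_conj hK
  obtain ⟨P, Q, rfl, rfl, hPQ⟩ := exists_factorization_traceNorm hρ.1 hτ.1
  obtain ⟨S, hS⟩ := exists_defect (k := m ⊕ m) hK
  have hF := re_trace_mul_conjTranspose_le_traceNorm (reshape (K * P)) (reshape (K * Q))
  rw [← partialTrace_conj_mul_conjTranspose, ← partialTrace_conj_mul_conjTranspose,
    ← partialTrace_conj_mul_conjTranspose, trace_partialTrace] at hF
  -- The overlap lost under `K` is bounded by the traces lost; `h` below absorbs it, with the old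
  -- defect term, into the defect term of the images.
  have hCS := re_trace_mul_conjTranspose_le (Sᴴ * P) (Sᴴ * Q)
  have e1 := congrArg Complex.re (hS P P)
  have e2 := congrArg Complex.re (hS Q Q)
  have e3 := congrArg Complex.re (hS P Q)
  have n1 := re_trace_mul_conjTranspose_self_nonneg (Sᴴ * P)
  have n2 := re_trace_mul_conjTranspose_self_nonneg (Sᴴ * Q)
  have h := sqrt_mul_add_sqrt_mul_le n1 n2 (sub_nonneg.mpr hρ.2) (sub_nonneg.mpr hτ.2)
  rw [Complex.add_re] at e1 e2 e3
  have h4 : ((Sᴴ * P) * (Sᴴ * P)ᴴ).trace.re + (1 - (P * Pᴴ).trace.re) =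
      1 - (K * (P * Pᴴ) * Kᴴ).trace.re := by linarith
  have h5 : ((Sᴴ * Q) * (Sᴴ * Q)ᴴ).trace.re + (1 - (Q * Qᴴ).trace.re) =
      1 - (K * (Q * Qᴴ) * Kᴴ).trace.re := by linarith
  rw [h4, h5] at h
  unfold fidelity
  rw [trace_partialTrace, trace_partialTrace]
  linarith

theorem fidelity_nonneg (ρ τ : Matrix n n ℂ) : 0 ≤ fidelity ρ τ :=
  add_nonneg (traceNorm_nonneg _) (Real.sqrt_nonneg _)

theorem purifiedDist_partialTrace_le [DecidableEq r] {K : Matrix (n × r) m ℂ} (hK : ‖K‖ ≤ 1)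
    {ρ τ : Matrix m m ℂ} (hρ : IsState ρ) (hτ : IsState τ) :
    purifiedDist (partialTrace (K * ρ * Kᴴ)) (partialTrace (K * τ * Kᴴ)) ≤ purifiedDist ρ τ := by
  apply Real.sqrt_le_sqrt
  have h1 := fidelity_le_fidelity_partialTrace hK hρ hτ
  have h2 := fidelity_nonneg ρ τ
  gcongr

theorem purifiedDist_self {ρ : Matrix n n ℂ} (hρ : IsState ρ) : purifiedDist ρ ρ = 0 := by
  have h : 1 ≤ fidelity ρ ρ := by
    obtain ⟨P, hP⟩ := PosSemidef.exists_mul_conjTranspose hρ.1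
    have h1 := re_trace_mul_conjTranspose_le_traceNorm P P
    rw [hP] at h1
    have h2 := hρ.2
    rw [fidelity, Real.sqrt_mul_self (by linarith)]
    linarith
  -- Fidelity at least `1` suffices: `Real.sqrt` vanishes on nonpositive numbers.
  rw [purifiedDist, Real.sqrt_eq_zero']
  nlinarith

/-- Cauchy-Schwarz, with `tr ρ` and `1 - tr τ` bounded by `1`. It keeps the trace of states near `ρ`
away from zero. -/
theorem fidelity_le_sqrt_add_sqrt {ρ τ : Matrix n n ℂ} (hρ : IsState ρ) (hτ : IsState τ) :
    fidelity ρ τ ≤ √τ.trace.re + √(1 - ρ.trace.re) := by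
  obtain ⟨P, Q, hP, hQ, hPQ⟩ := exists_factorization_traceNorm hρ.1 hτ.1
  have h1 := re_trace_mul_conjTranspose_le P Q
  rw [hPQ, hP, hQ] at h1
  have p1 : 0 ≤ ρ.trace.re := (Complex.le_def.mp hρ.1.trace_nonneg).1
  have p2 : 0 ≤ τ.trace.re := (Complex.le_def.mp hτ.1.trace_nonneg).1
  have h2 := hρ.2
  have h3 := hτ.2
  refine add_le_add (h1.trans (Real.sqrt_le_sqrt ?_)) (Real.sqrt_le_sqrt ?_) <;> nlinarith

end PartialTrace

/-! ### Coherent measurements and purifications of the measured states -/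

section Measurement

variable {A B C E R X Z D : Type*} [Fintype A] [DecidableEq A] [Fintype B] [DecidableEq B]
  [Fintype C] [DecidableEq C] [Fintype E] [DecidableEq E] [Fintype R] [DecidableEq R]
  [Fintype X] [DecidableEq X] [Fintype Z] [DecidableEq Z] [Fintype D] [DecidableEq D]

/-- The isometry `∑ₓ |x⟩|x⟩ ⊗ √Mₓ ⊗ 1` that implements a measurement coherently. -/
noncomputable def measurementIsometry (R : Type*) [DecidableEq R] (M : X → Matrix A A ℂ) :
    Matrix (X × X × A × R) (A × R) ℂ :=
  Matrix.of fun p q => if p.1 = p.2.1 ∧ p.2.2.2 = q.2 then CFC.sqrt (M p.1) p.2.2.1 q.1 else 0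

theorem measurementIsometry_isometry {M : X → Matrix A A ℂ} (hM : IsPOVM M) :
    (measurementIsometry R M)ᴴ * measurementIsometry R M = 1 := by
  ext ⟨a, s⟩ ⟨a', s'⟩
  have h1 : ∀ x, ∑ a'', star (CFC.sqrt (M x) a'' a) * CFC.sqrt (M x) a'' a' = M x a a' := by
    intro x
    conv_rhs => rw [← PosSemidef.sqrt_mul_sqrt (hM.1 x)]
    conv_rhs => enter [1]; rw [← sqrt_conjTranspose]
    rfl
  have h2 : ∑ x, M x a a' = (1 : Matrix A A ℂ) a a' := by
    rw [← hM.2, Matrix.sum_apply]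
  simp only [measurementIsometry, Matrix.mul_apply, conjTranspose_apply, of_apply,
    Fintype.sum_prod_type]
  by_cases hs : s = s'
  · subst hs
    simp only [ite_and, apply_ite star, star_zero, ite_mul, mul_ite, zero_mul, mul_zero,
      Finset.sum_ite_eq, Finset.sum_ite_eq', Finset.mem_univ, if_true, Finset.sum_ite_irrel,
      Finset.sum_const_zero]
    simp only [h1, h2]
    simp [Matrix.one_apply]
  · rw [Matrix.one_apply_ne (by simp [hs])]
    refine Finset.sum_eq_zero fun x _ => Finset.sum_eq_zero fun x' _ =>
      Finset.sum_eq_zero fun a'' _ => Finset.sum_eq_zero fun s'' _ => ?_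
    split_ifs with h3 h4
    · exact absurd (h3.2.symm.trans h4.2) hs
    all_goals simp

/-- Exchange the third row index with the column index. -/
def swapThird {A B C E : Type*} (T : Matrix (A × B × C) E ℂ) : Matrix (A × B × E) C ℂ :=
  Matrix.of fun p c => T (p.1, p.2.1, c) p.2.2

omit [Fintype X] in
-- If `T * Tᴴ = ρ_ABC`, then `T` is a purification with purifying system `E`, and `swapThird T` is a
-- factor of its marginal on `ABE`.
theorem measurementIsometry_mul_swapThird (M : X → Matrix A A ℂ) (T : Matrix (A × B × C) E ℂ)
    (x x' : X) (a : A) (b : B) (e : E) (c : C) :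
    (measurementIsometry (B × E) M * swapThird T) (x, x', a, b, e) c =
      if x = x' then ((CFC.sqrt (M x) ⊗ₖ (1 : Matrix (B × C) (B × C) ℂ)) * T) (a, b, c) e
      else 0 := by
  simp only [measurementIsometry, swapThird, Matrix.mul_apply, of_apply, Fintype.sum_prod_type,
    kroneckerMap_apply, Matrix.one_apply, Prod.mk.injEq]
  by_cases h : x = x'
  · simp [h, ite_and]
  · simp [h]

theorem sum_single_kronecker_apply {β : Type*} (T : X → Matrix β β ℂ) (x x' : X)
    (b b' : β) :
    (∑ y, Matrix.single y y (1 : ℂ) ⊗ₖ T y) (x, b) (x', b') = if x = x' then T x b b' else 0 := by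
  simp only [Matrix.sum_apply, kroneckerMap_apply, Matrix.single_apply]
  by_cases h : x = x'
  · subst h; simp
  · simp only [if_neg h]
    refine Finset.sum_eq_zero fun y _ => ?_
    rw [if_neg (by rintro ⟨rfl, rfl⟩; exact h rfl), zero_mul]

omit [DecidableEq A] in
theorem kronecker_one_mul_apply {β γ : Type*} [Fintype β] [DecidableEq β] (S : Matrix A A ℂ)
    (T : Matrix (A × β) γ ℂ) (a : A) (b : β) (q : γ) :
    ((S ⊗ₖ (1 : Matrix β β ℂ)) * T) (a, b) q = ∑ a', S a a' * T (a', b) q := by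
  simp [Matrix.mul_apply, Fintype.sum_prod_type, Matrix.one_apply]

omit [DecidableEq A] in
theorem mul_kronecker_one_apply {β γ : Type*} [Fintype β] [DecidableEq β] (S : Matrix A A ℂ)
    (T : Matrix γ (A × β) ℂ) (a : A) (b : β) (q : γ) :
    (T * (S ⊗ₖ (1 : Matrix β β ℂ))) q (a, b) = ∑ a', T q (a', b) * S a' a := by
  simp [Matrix.mul_apply, Fintype.sum_prod_type, Matrix.one_apply]

omit [DecidableEq A] in
theorem trace13_kronecker_one_mul_comm (S : Matrix A A ℂ)
    (T : Matrix (A × B × C) (A × B × C) ℂ) :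
    trace13 ((S ⊗ₖ (1 : Matrix (B × C) (B × C) ℂ)) * T) =
      trace13 (T * (S ⊗ₖ (1 : Matrix (B × C) (B × C) ℂ))) := by
  ext b b'
  simp only [trace13, of_apply, kronecker_one_mul_apply, mul_kronecker_one_apply]
  rw [Finset.sum_comm, Finset.sum_comm (s := (Finset.univ : Finset A))]
  refine Finset.sum_congr rfl fun c _ => ?_
  rw [Finset.sum_comm]
  simp only [mul_comm]

omit [DecidableEq A] in
theorem trace12_kronecker_one_mul_comm (S : Matrix A A ℂ)
    (T : Matrix (A × B × C) (A × B × C) ℂ) :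
    trace12 ((S ⊗ₖ (1 : Matrix (B × C) (B × C) ℂ)) * T) =
      trace12 (T * (S ⊗ₖ (1 : Matrix (B × C) (B × C) ℂ))) := by
  ext b b'
  simp only [trace12, of_apply, kronecker_one_mul_apply, mul_kronecker_one_apply]
  rw [Finset.sum_comm, Finset.sum_comm (s := (Finset.univ : Finset A))]
  refine Finset.sum_congr rfl fun c _ => ?_
  rw [Finset.sum_comm]
  simp only [mul_comm]

theorem sqrt_kronecker_mul_conjTranspose {β γ : Type*} [Fintype β] [DecidableEq β] [Fintype γ]
    {S : Matrix A A ℂ} (T : Matrix (A × β) γ ℂ) :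
    ((CFC.sqrt S ⊗ₖ (1 : Matrix β β ℂ)) * T) * ((CFC.sqrt S ⊗ₖ (1 : Matrix β β ℂ)) * T)ᴴ =
      (CFC.sqrt S ⊗ₖ (1 : Matrix β β ℂ)) * (T * Tᴴ * (CFC.sqrt S ⊗ₖ (1 : Matrix β β ℂ))) := by
  rw [conjTranspose_mul, conjTranspose_kronecker, sqrt_conjTranspose, conjTranspose_one]
  simp only [Matrix.mul_assoc]

theorem PosSemidef.sqrt_kronecker_mul_sqrt_kronecker {β : Type*} [Fintype β] [DecidableEq β]
    {S : Matrix A A ℂ} (hS : S.PosSemidef) :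
    (CFC.sqrt S ⊗ₖ (1 : Matrix β β ℂ)) * (CFC.sqrt S ⊗ₖ (1 : Matrix β β ℂ)) = S ⊗ₖ 1 := by
  rw [← mul_kronecker_mul, PosSemidef.sqrt_mul_sqrt hS, Matrix.mul_one]

omit [DecidableEq E] in
-- One factor of `M x = √M_x √M_x` moves around the trace over `A`, which leaves a Gram form.
theorem measuredB_apply {M : X → Matrix A A ℂ} (hM : IsPOVM M)
    (T : Matrix (A × B × C) E ℂ) (x x' : X) (b b' : B) :
    measuredB M (T * Tᴴ) (x, b) (x', b') = if x = x' then
      ∑ a, ∑ c, ∑ e, ((CFC.sqrt (M x) ⊗ₖ (1 : Matrix (B × C) (B × C) ℂ)) * T) (a, b, c) e *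
        star (((CFC.sqrt (M x) ⊗ₖ (1 : Matrix (B × C) (B × C) ℂ)) * T) (a, b', c) e) else 0 := by
  rw [measuredB, sum_single_kronecker_apply]
  congr 1
  rw [← PosSemidef.sqrt_kronecker_mul_sqrt_kronecker (hM.1 x), Matrix.mul_assoc,
    trace13_kronecker_one_mul_comm, Matrix.mul_assoc, ← sqrt_kronecker_mul_conjTranspose]
  rfl

omit [DecidableEq E] in
theorem measuredC_apply {N : Z → Matrix A A ℂ} (hN : IsPOVM N)
    (T : Matrix (A × B × C) E ℂ) (z z' : Z) (c c' : C) :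
    measuredC N (T * Tᴴ) (z, c) (z', c') = if z = z' then
      ∑ a, ∑ b, ∑ e, ((CFC.sqrt (N z) ⊗ₖ (1 : Matrix (B × C) (B × C) ℂ)) * T) (a, b, c) e *
        star (((CFC.sqrt (N z) ⊗ₖ (1 : Matrix (B × C) (B × C) ℂ)) * T) (a, b, c') e) else 0 := by
  rw [measuredC, sum_single_kronecker_apply]
  congr 1
  rw [← PosSemidef.sqrt_kronecker_mul_sqrt_kronecker (hN.1 z), Matrix.mul_assoc,
    trace12_kronecker_one_mul_comm, Matrix.mul_assoc, ← sqrt_kronecker_mul_conjTranspose]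
  rfl

/-- Regroup the output of the coherent measurement into `X ⊗ B` and the system to be traced out. -/
def splitXB (X A B E : Type*) : (X × B) × (X × A × E) ≃ X × X × A × B × E where
  toFun p := (p.1.1, p.2.1, p.2.2.1, p.1.2, p.2.2.2)
  invFun q := ((q.1, q.2.2.2.1), (q.2.1, q.2.2.1, q.2.2.2.2))
  left_inv _ := rfl
  right_inv _ := rfl

/-- The Stinespring dilation of the map that measures `M` and keeps the outcome and `B`. -/
noncomputable def measurementDilation (E B : Type*) [DecidableEq E] [DecidableEq B]
    (M : X → Matrix A A ℂ) : Matrix ((X × B) × (X × A × E)) (A × B × E) ℂ :=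
  (measurementIsometry (B × E) M).submatrix (splitXB X A B E) id

theorem norm_measurementDilation_le_one {M : X → Matrix A A ℂ} (hM : IsPOVM M) :
    ‖measurementDilation E B M‖ ≤ 1 := by
  apply norm_le_one_of_conjTranspose_mul_self
  rw [measurementDilation, conjTranspose_submatrix, submatrix_mul_equiv,
    measurementIsometry_isometry hM, submatrix_id_id]

/-- Tracing out the second copy of the outcome removes the coherences between different `x`. -/
theorem partialTrace_measurementDilation {M : X → Matrix A A ℂ} (hM : IsPOVM M)
    (T : Matrix (A × B × C) E ℂ) :
    partialTrace ((measurementDilation E B M * swapThird T) *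
      (measurementDilation E B M * swapThird T)ᴴ) = measuredB M (T * Tᴴ) := by
  have hK : measurementDilation E B M * swapThird T =
      (measurementIsometry (B × E) M * swapThird T).submatrix (splitXB X A B E) id := by
    rw [measurementDilation, ← submatrix_mul_equiv _ _ _ (Equiv.refl _) _]
    simp
  ext ⟨x, b⟩ ⟨x', b'⟩
  rw [measuredB_apply hM, hK]
  simp only [partialTrace, of_apply, Matrix.mul_apply (N := _ᴴ), submatrix_apply,
    conjTranspose_apply, splitXB, Equiv.coe_fn_mk, id,
    measurementIsometry_mul_swapThird, Fintype.sum_prod_type]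
  by_cases h : x = x'
  · subst h
    simp only [apply_ite star, star_zero, ite_mul, mul_ite, zero_mul, mul_zero, if_true,
      Finset.sum_ite_irrel, Finset.sum_const_zero]
    simp only [Finset.sum_ite_eq, Finset.mem_univ, if_true]
    exact Finset.sum_congr rfl fun a _ => Finset.sum_comm
  · simp only [if_neg h]
    refine Finset.sum_eq_zero fun y _ => Finset.sum_eq_zero fun a _ =>
      Finset.sum_eq_zero fun e _ => Finset.sum_eq_zero fun c _ => ?_
    split_ifs with h1 h2
    · exact absurd (h1.trans h2.symm) h
    all_goals simp

/-- The measured state `ρ_ZC` is purified by the coherent measurement; any other purification is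
mapped to this one by a contraction on the purifying system. -/
theorem exists_contraction_of_purification {N : Z → Matrix A A ℂ} (hN : IsPOVM N)
    (T : Matrix (A × B × C) E ℂ) (ψ : Z × C × D → ℂ)
    (hψ : trace3 (pureState ψ) = measuredC N (T * Tᴴ)) :
    ∃ W : Matrix (Z × A × B × E) D ℂ, ‖W‖ ≤ 1 ∧
      ((1 : Matrix Z Z ℂ) ⊗ₖ W) * (Matrix.of fun (p : Z × D) (c : C) => ψ (p.1, c, p.2)) =
        measurementIsometry (B × E) N * swapThird T := by
  -- Read as matrices from `ZC` to the purifying system, both purifications have the transpose of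
  -- `ρ_ZC` as Gram matrix.
  obtain ⟨W, hW, hWG, -⟩ := exists_contraction_of_gram_eq
    (G := Matrix.of fun (k : Z × A × B × E) (p : Z × C) =>
      (measurementIsometry (B × E) N * swapThird T) (p.1, k) p.2)
    (H := Matrix.of fun (d : D) (p : Z × C) => ψ (p.1, p.2, d)) (by
      ext ⟨z, c⟩ ⟨z', c'⟩
      have h := congrFun (congrFun hψ (z', c')) (z, c)
      rw [measuredC_apply hN] at h
      simp only [trace3, pureState, of_apply, vecMulVec_apply, Pi.star_apply] at h
      simp only [Matrix.mul_apply (M := _ᴴ), conjTranspose_apply, of_apply,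
        Fintype.sum_prod_type, measurementIsometry_mul_swapThird]
      rw [Finset.sum_congr rfl fun d _ => mul_comm (star (ψ (z, c, d))) _, h]
      by_cases hz : z' = z
      · subst hz
        simp only [apply_ite star, star_zero, ite_mul, mul_ite, zero_mul, mul_zero, if_true,
          Finset.sum_ite_irrel, Finset.sum_const_zero]
        simp only [Finset.sum_ite_eq, Finset.mem_univ, if_true, mul_comm]
      · rw [if_neg hz]
        refine Finset.sum_eq_zero fun y _ => Finset.sum_eq_zero fun a _ =>
          Finset.sum_eq_zero fun e _ => Finset.sum_eq_zero fun c _ => ?_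
        split_ifs with h1 h2
        · exact absurd (h2.trans h1.symm) hz
        all_goals simp)
  refine ⟨W, hW, ?_⟩
  ext ⟨z, k⟩ c
  have := congrFun (congrFun hWG k) (z, c)
  simp only [of_apply] at this
  rw [← this]
  simp [Matrix.mul_apply, Fintype.sum_prod_type, Matrix.one_apply]

omit [DecidableEq R] in
theorem norm_one_kronecker_le_one {W : Matrix R D ℂ} (hW : ‖W‖ ≤ 1) :
    ‖(1 : Matrix Z Z ℂ) ⊗ₖ W‖ ≤ 1 := by
  have h1 : (1 : Matrix Z Z ℂ) ⊗ₖ (1 : Matrix D D ℂ) - 1 ⊗ₖ (Wᴴ * W) = 1 ⊗ₖ (1 - Wᴴ * W) :=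
    sub_eq_of_eq_add (by rw [← kronecker_add, sub_add_cancel])
  have h : ((1 : Matrix Z Z ℂ) ⊗ₖ W)ᴴ * ((1 : Matrix Z Z ℂ) ⊗ₖ W) ≤ 1 := by
    rw [conjTranspose_kronecker, ← mul_kronecker_mul, conjTranspose_one, Matrix.mul_one,
      Matrix.le_iff, ← one_kronecker_one, h1]
    exact PosSemidef.one.kronecker ((Matrix.le_iff).mp (conjTranspose_mul_self_le_one hW))
  have h0 := (posSemidef_conjTranspose_mul_self ((1 : Matrix Z Z ℂ) ⊗ₖ W)).nonneg
  rw [← CStarAlgebra.norm_le_one_iff_of_nonneg _ h0, l2_opNorm_conjTranspose_mul_self] at h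
  nlinarith [norm_nonneg ((1 : Matrix Z Z ℂ) ⊗ₖ W)]

end Measurement

/-! ### Comparing positive operators through their factors -/

theorem star_dotProduct_mul_conjTranspose_mulVec {n m : Type*} [Fintype n] [Fintype m]
    (F : Matrix n m ℂ) (u : n → ℂ) :
    star u ⬝ᵥ ((F * Fᴴ) *ᵥ u) = ((∑ q, ‖(star u ᵥ* F) q‖ ^ 2 : ℝ) : ℂ) := by
  have h : Fᴴ *ᵥ u = star (star u ᵥ* F) := by rw [star_vecMul, star_star]
  rw [← mulVec_mulVec, dotProduct_mulVec, h, dotProduct]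
  push_cast
  refine Finset.sum_congr rfl fun q _ => ?_
  simpa using Complex.mul_conj' ((star u ᵥ* F) q)

/-- The quadratic form of `F * Fᴴ` at `u` is the squared norm of the row vector `star u ᵥ* F`. -/
theorem mul_conjTranspose_le_of_vecMul {n m k : Type*} [Fintype n] [Fintype m] [Fintype k]
    {G : Matrix n m ℂ} {H : Matrix n k ℂ}
    (h : ∀ u : n → ℂ, ∑ q, ‖(u ᵥ* G) q‖ ^ 2 ≤ ∑ q, ‖(u ᵥ* H) q‖ ^ 2) : G * Gᴴ ≤ H * Hᴴ := by
  rw [Matrix.le_iff]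
  refine PosSemidef.of_dotProduct_mulVec_nonneg
    ((isHermitian_mul_conjTranspose_self H).sub (isHermitian_mul_conjTranspose_self G)) fun u => ?_
  rw [sub_mulVec, dotProduct_sub, star_dotProduct_mul_conjTranspose_mulVec,
    star_dotProduct_mul_conjTranspose_mulVec, ← Complex.ofReal_sub, Complex.zero_le_real]
  exact sub_nonneg.mpr (h _)

theorem sum_norm_mulVec_sq_le {n m : Type*} [Fintype n] [Fintype m] [DecidableEq m]
    (L : Matrix n m ℂ) (w : m → ℂ) :
    ∑ i, ‖(L *ᵥ w) i‖ ^ 2 ≤ ‖L‖ ^ 2 * ∑ j, ‖w j‖ ^ 2 := by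
  have h := l2_opNorm_mulVec L (WithLp.toLp 2 w)
  have h2 := pow_le_pow_left₀ (norm_nonneg _) h 2
  rw [mul_pow, EuclideanSpace.norm_sq_eq, EuclideanSpace.norm_sq_eq] at h2
  exact h2

/-! ### The map from `ZD` to `XB` and the overlap bound -/

section Channel

variable {A B C E X Z D : Type*} [Fintype A] [DecidableEq A] [Fintype B] [DecidableEq B]
  [Fintype C] [DecidableEq C] [Fintype E] [DecidableEq E]
  [Fintype X] [DecidableEq X] [Fintype Z] [DecidableEq Z] [Fintype D] [DecidableEq D]

/-- The Stinespring dilation of the map that undoes the coherent measurement `N` and then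
measures `M`. -/
noncomputable def exchangeDilation (M : X → Matrix A A ℂ) (N : Z → Matrix A A ℂ)
    (W : Matrix (Z × A × B × E) D ℂ) : Matrix ((X × B) × (X × A × E)) (Z × D) ℂ :=
  measurementDilation E B M * ((measurementIsometry (B × E) N)ᴴ * ((1 : Matrix Z Z ℂ) ⊗ₖ W))

theorem norm_exchangeDilation_le_one {M : X → Matrix A A ℂ} (hM : IsPOVM M)
    {N : Z → Matrix A A ℂ} (hN : IsPOVM N) {W : Matrix (Z × A × B × E) D ℂ} (hW : ‖W‖ ≤ 1) :
    ‖exchangeDilation M N W‖ ≤ 1 := by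
  refine norm_mul_le_one (norm_measurementDilation_le_one hM)
    (norm_mul_le_one ?_ (norm_one_kronecker_le_one hW))
  rw [l2_opNorm_conjTranspose]
  exact norm_le_one_of_conjTranspose_mul_self (measurementIsometry_isometry hN)

omit [Fintype X] [Fintype D] [DecidableEq D] in
-- The adjoint of the isometry for `N` selects equal copies of `z` and applies `√N_z`; measuring `M`
-- then applies `√M_x`. This is where the product in the overlap arises.
theorem exchangeDilation_apply (M : X → Matrix A A ℂ) (N : Z → Matrix A A ℂ)
    (W : Matrix (Z × A × B × E) D ℂ) (x x' : X) (a : A) (b : B) (e : E) (z : Z) (d : D) :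
    exchangeDilation M N W ((x, b), (x', a, e)) (z, d) =
      if x = x' then ((CFC.sqrt (M x) * CFC.sqrt (N z)) *ᵥ fun a' => W (z, a', b, e) d) a
      else 0 := by
  have h1 : ∀ (a : A) (b : B) (e : E),
      ((measurementIsometry (B × E) N)ᴴ * ((1 : Matrix Z Z ℂ) ⊗ₖ W)) (a, b, e) (z, d) =
        (CFC.sqrt (N z) *ᵥ fun a' => W (z, a', b, e) d) a := by
    intro a b e
    conv_rhs => rw [← sqrt_conjTranspose]
    simp only [measurementIsometry, Matrix.mul_apply, conjTranspose_apply, of_apply, mulVec,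
      dotProduct, Fintype.sum_prod_type, kroneckerMap_apply, Matrix.one_apply, Prod.mk.injEq]
    rw [Finset.sum_eq_single z (fun y _ hy => by simp only [if_neg hy, zero_mul, mul_zero,
        Finset.sum_const_zero]) (by simp),
      Finset.sum_eq_single z (fun y _ hy => by simp [hy.symm]) (by simp)]
    refine Finset.sum_congr rfl fun a' _ => ?_
    rw [Finset.sum_eq_single b (fun y _ hy => by simp [hy]) (by simp),
      Finset.sum_eq_single e (fun y _ hy => by simp [hy]) (by simp)]
    simp
  rw [exchangeDilation, ← mulVec_mulVec, Matrix.mul_apply]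
  simp only [Fintype.sum_prod_type, h1]
  simp only [measurementDilation, measurementIsometry, splitXB, submatrix_apply, of_apply,
    Equiv.coe_fn_mk, id, Prod.mk.injEq]
  by_cases h : x = x'
  · simp only [h, true_and, ite_and, if_true]
    simp [mulVec, dotProduct]
  · simp [h]

omit [Fintype X] [DecidableEq D] in
theorem exchangeDilation_mul (M : X → Matrix A A ℂ) (N : Z → Matrix A A ℂ)
    (W : Matrix (Z × A × B × E) D ℂ) (S : Matrix D D ℂ) :
    exchangeDilation M N W * ((1 : Matrix Z Z ℂ) ⊗ₖ S) = exchangeDilation M N (W * S) := by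
  simp only [exchangeDilation, Matrix.mul_assoc, ← mul_kronecker_mul, Matrix.one_mul]

/-- Regroup the rows so that everything but the second system can be traced out. -/
def regroupB (W : Matrix (Z × A × B × E) D ℂ) : Matrix (B × (A × E × Z)) D ℂ :=
  W.submatrix (fun p => (p.2.2.2, p.2.1, p.1, p.2.2.1)) id

omit [DecidableEq A] [DecidableEq B] [DecidableEq E] [DecidableEq Z] in
theorem norm_regroupB_le_one {W : Matrix (Z × A × B × E) D ℂ} (hW : ‖W‖ ≤ 1) :
    ‖regroupB W‖ ≤ 1 := by
  let f : B × (A × E × Z) ≃ Z × A × B × E :=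
    { toFun := fun p => (p.2.2.2, p.2.1, p.1, p.2.2.1)
      invFun := fun q => (q.2.2.1, q.2.1, q.2.2.2, q.1)
      left_inv := fun _ => rfl
      right_inv := fun _ => rfl }
  have h : (regroupB W)ᴴ * regroupB W = Wᴴ * W := by
    have : regroupB W = W.submatrix f id := rfl
    rw [this, conjTranspose_submatrix, submatrix_mul_equiv, submatrix_id_id]
  have h1 := l2_opNorm_conjTranspose_mul_self (regroupB W)
  rw [h, l2_opNorm_conjTranspose_mul_self] at h1
  nlinarith [norm_nonneg W, norm_nonneg (regroupB W)]

/-- Both sides are of the form `F * Fᴴ` once `σ = S * Sᴴ` is absorbed into `W`. Tested on a row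
vector, they compare `√M_x √N_z w` with `√c w` for the same vectors `w` in `A`. The operator on `B`
to the right is independent of `x`, as the min-entropy requires. -/
theorem partialTrace_exchangeDilation_le (M : X → Matrix A A ℂ) (N : Z → Matrix A A ℂ) {c : ℝ}
    (hc₀ : 0 ≤ c) (hc : ∀ x z, ‖CFC.sqrt (M x) * CFC.sqrt (N z)‖ ^ 2 ≤ c)
    (W : Matrix (Z × A × B × E) D ℂ) {σ : Matrix D D ℂ} (hσ : σ.PosSemidef) :
    partialTrace (exchangeDilation M N W * ((1 : Matrix Z Z ℂ) ⊗ₖ σ) *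
        (exchangeDilation M N W)ᴴ) ≤
      c • ((1 : Matrix X X ℂ) ⊗ₖ partialTrace (regroupB W * σ * (regroupB W)ᴴ)) := by
  obtain ⟨S, rfl⟩ := PosSemidef.exists_mul_conjTranspose hσ
  have h1 : (1 : Matrix Z Z ℂ) ⊗ₖ (S * Sᴴ) = (1 ⊗ₖ S) * (1 ⊗ₖ S)ᴴ := by
    rw [conjTranspose_kronecker, ← mul_kronecker_mul, conjTranspose_one, Matrix.one_mul]
  have h2 : c • ((1 : Matrix X X ℂ) ⊗ₖ (reshape (regroupB (W * S)) *
      (reshape (regroupB (W * S)))ᴴ)) =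
      ((√c : ℝ) • ((1 : Matrix X X ℂ) ⊗ₖ reshape (regroupB (W * S)))) *
        ((√c : ℝ) • ((1 : Matrix X X ℂ) ⊗ₖ reshape (regroupB (W * S))))ᴴ := by
    rw [conjTranspose_smul, conjTranspose_kronecker, Matrix.smul_mul, Matrix.mul_smul, smul_smul,
      ← mul_kronecker_mul, conjTranspose_one, Matrix.one_mul, star_trivial,
      Real.mul_self_sqrt hc₀]
  have h3 : regroupB W * S = regroupB (W * S) := rfl
  rw [h1, partialTrace_conj_mul_conjTranspose, partialTrace_conj_mul_conjTranspose,
    exchangeDilation_mul, h3, h2]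
  generalize W * S = Y
  refine mul_conjTranspose_le_of_vecMul fun u => ?_
  have hG : ∀ x a e z d, (u ᵥ* reshape (exchangeDilation M N Y)) ((x, a, e), (z, d)) =
      ((CFC.sqrt (M x) * CFC.sqrt (N z)) *ᵥ fun a' => ∑ b, u (x, b) * Y (z, a', b, e) d) a := by
    intro x a e z d
    simp only [vecMul, dotProduct, reshape, of_apply, Fintype.sum_prod_type,
      exchangeDilation_apply, mulVec, mul_ite, mul_zero, Finset.mul_sum]
    rw [Finset.sum_eq_single x (fun y _ hy => by simp [hy]) (by simp)]
    simp only [if_true]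
    rw [Finset.sum_comm]
    refine Finset.sum_congr rfl fun _ _ => Finset.sum_congr rfl fun _ _ => by ring
  have hH : ∀ x a e z d, (u ᵥ* ((√c : ℝ) • ((1 : Matrix X X ℂ) ⊗ₖ reshape (regroupB Y))))
      (x, ((a, e, z), d)) = (√c : ℝ) • ∑ b, u (x, b) * Y (z, a, b, e) d := by
    intro x a e z d
    rw [vecMul_smul, Pi.smul_apply]
    congr 1
    simp only [vecMul, dotProduct, reshape, regroupB, of_apply, Fintype.sum_prod_type,
      kroneckerMap_apply, Matrix.one_apply, submatrix_apply, id]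
    rw [Finset.sum_eq_single x (fun y _ hy => by simp [hy]) (by simp)]
    simp
  have hsum : ∀ f : A → E → Z → D → ℝ,
      ∑ a, ∑ e, ∑ z, ∑ d, f a e z d = ∑ e, ∑ z, ∑ d, ∑ a, f a e z d := by
    intro f
    rw [Finset.sum_comm]
    refine Finset.sum_congr rfl fun e _ => ?_
    rw [Finset.sum_comm]
    refine Finset.sum_congr rfl fun z _ => ?_
    rw [Finset.sum_comm]
  simp only [Fintype.sum_prod_type, hG, hH]
  refine Finset.sum_le_sum fun x _ => ?_
  -- With the sum over `a` innermost, the bound holds separately for each `e`, `z`, `d`.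
  rw [hsum, hsum]
  refine Finset.sum_le_sum fun e _ => Finset.sum_le_sum fun z _ => Finset.sum_le_sum fun d _ => ?_
  refine (sum_norm_mulVec_sq_le _ _).trans ?_
  simp only [norm_smul, mul_pow, ← Finset.mul_sum, Real.norm_eq_abs, sq_abs, Real.sq_sqrt hc₀]
  gcongr
  exact hc x z

theorem smul_mono_left {n : Type*} [Fintype n] {a b : ℝ} (h : a ≤ b) {T : Matrix n n ℂ}
    (hT : T.PosSemidef) : a • T ≤ b • T := by
  rw [Matrix.le_iff, ← sub_smul]
  exact hT.smul (sub_nonneg.mpr h)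

theorem smul_mono_right {n : Type*} [Fintype n] {a : ℝ} (ha : 0 ≤ a) {S T : Matrix n n ℂ}
    (h : S ≤ T) : a • S ≤ a • T := by
  rw [Matrix.le_iff] at h ⊢
  rw [← smul_sub]
  exact h.smul ha

omit [Fintype X] [DecidableEq X] [Fintype Z] [DecidableEq Z] in
theorem overlap_nonneg (M : X → Matrix A A ℂ) (N : Z → Matrix A A ℂ) : 0 ≤ overlap M N :=
  Real.iSup_nonneg fun _ => sq_nonneg _

omit [DecidableEq X] [DecidableEq Z] in
theorem norm_sqrt_mul_sqrt_sq_le_overlap (M : X → Matrix A A ℂ) (N : Z → Matrix A A ℂ)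
    (x : X) (z : Z) : ‖CFC.sqrt (M x) * CFC.sqrt (N z)‖ ^ 2 ≤ overlap M N :=
  le_ciSup (f := fun p : X × Z => ‖CFC.sqrt (M p.1) * CFC.sqrt (N p.2)‖ ^ 2)
    (Set.finite_range _).bddAbove (x, z)

omit [Fintype X] [DecidableEq X] [Fintype Z] [DecidableEq Z] in
theorem overlap_le_rpow_neg_incompatibility (M : X → Matrix A A ℂ) (N : Z → Matrix A A ℂ) :
    overlap M N ≤ (2 : ℝ) ^ (-incompatibility M N) := by
  rcases (overlap_nonneg M N).eq_or_lt with h | h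
  -- For zero overlap, `logb 2 (1 / 0) = 0`, so the right-hand side is `1`.
  · rw [← h]; positivity
  · rw [incompatibility, one_div, Real.logb_inv, neg_neg,
      Real.rpow_logb (by norm_num) (by norm_num) h]

omit [DecidableEq X] in
theorem IsPOVM.sum_kronecker_one {β : Type*} [Fintype β] [DecidableEq β] {M : X → Matrix A A ℂ}
    (hM : IsPOVM M) : ∑ x, M x ⊗ₖ (1 : Matrix β β ℂ) = 1 := by
  rw [← one_kronecker_one (m := A), ← hM.2]
  ext p q
  simp only [Matrix.sum_apply, kroneckerMap_apply, Finset.sum_mul]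

theorem trace_measuredB {M : X → Matrix A A ℂ} (hM : IsPOVM M)
    (ρ : Matrix (A × B × C) (A × B × C) ℂ) : (measuredB M ρ).trace = ρ.trace := by
  have h : ∀ T : Matrix (A × B × C) (A × B × C) ℂ, (trace13 T).trace = T.trace := by
    intro T
    simp only [trace13, Matrix.trace, diag_apply, of_apply, Fintype.sum_prod_type]
    exact Finset.sum_comm
  have h2 : ∑ x, (M x ⊗ₖ (1 : Matrix (B × C) (B × C) ℂ)) * ρ = ρ := by
    rw [← Matrix.sum_mul, hM.sum_kronecker_one, Matrix.one_mul]
  rw [measuredB, trace_sum]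
  simp only [trace_kronecker, trace_single_eq_same, one_mul, h]
  rw [← trace_sum, h2]

theorem trace_measuredC {N : Z → Matrix A A ℂ} (hN : IsPOVM N)
    (ρ : Matrix (A × B × C) (A × B × C) ℂ) : (measuredC N ρ).trace = ρ.trace := by
  have h : ∀ T : Matrix (A × B × C) (A × B × C) ℂ, (trace12 T).trace = T.trace := by
    intro T
    simp only [trace12, Matrix.trace, diag_apply, of_apply, Fintype.sum_prod_type]
    rw [Finset.sum_comm]
    refine Finset.sum_congr rfl fun _ _ => Finset.sum_comm
  have h2 : ∑ x, (N x ⊗ₖ (1 : Matrix (B × C) (B × C) ℂ)) * ρ = ρ := by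
    rw [← Matrix.sum_mul, hN.sum_kronecker_one, Matrix.one_mul]
  rw [measuredC, trace_sum]
  simp only [trace_kronecker, trace_single_eq_same, one_mul, h]
  rw [← trace_sum, h2]

theorem isState_measuredB {M : X → Matrix A A ℂ} (hM : IsPOVM M)
    {ρ : Matrix (A × B × C) (A × B × C) ℂ} (hρ : IsState ρ) : IsState (measuredB M ρ) := by
  refine ⟨?_, by rw [trace_measuredB hM]; exact hρ.2⟩
  obtain ⟨T, rfl⟩ := PosSemidef.exists_mul_conjTranspose hρ.1
  rw [← partialTrace_measurementDilation hM, ← reshape_mul_conjTranspose]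
  exact posSemidef_self_mul_conjTranspose _

omit [DecidableEq C] [Fintype Z] [DecidableEq Z] [Fintype D] [DecidableEq D] in
theorem trace2_pureState (ψ : Z × C × D → ℂ) : trace2 (pureState ψ) =
    (Matrix.of fun (p : Z × D) (c : C) => ψ (p.1, c, p.2)) *
      (Matrix.of fun (p : Z × D) (c : C) => ψ (p.1, c, p.2))ᴴ := by
  ext p p'
  simp [trace2, pureState, Matrix.mul_apply, vecMulVec_apply]

omit [DecidableEq C] [DecidableEq Z] [DecidableEq D] in
theorem isState_trace2_pureState {ψ : Z × C × D → ℂ}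
    (h : (trace3 (pureState ψ)).trace.re ≤ 1) : IsState (trace2 (pureState ψ)) := by
  refine ⟨by rw [trace2_pureState]; exact posSemidef_self_mul_conjTranspose _, ?_⟩
  convert h using 2
  simp only [trace2, trace3, Matrix.trace, diag_apply, of_apply, Fintype.sum_prod_type]
  refine Finset.sum_congr rfl fun _ _ => Finset.sum_comm

/-- The uncertainty relation for one purification of the state of `Z` and `C`. -/
theorem smoothMinEntropy_purification_le {ρ : Matrix (A × B × C) (A × B × C) ℂ} (hρ : IsState ρ)
    {M : X → Matrix A A ℂ} (hM : IsPOVM M) {N : Z → Matrix A A ℂ} (hN : IsPOVM N) (ε : ℝ)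
    (ψ : Z × C × D → ℂ) (hψ : trace3 (pureState ψ) = measuredC N ρ) :
    smoothMinEntropy ε (trace2 (pureState ψ)) ≤
      smoothMinEntropy ε (measuredB M ρ) - (incompatibility M N : EReal) := by
  have hω : IsState (trace2 (pureState ψ)) :=
    isState_trace2_pureState (by rw [hψ, trace_measuredC hN]; exact hρ.2)
  obtain ⟨T, hT⟩ := PosSemidef.exists_mul_conjTranspose hρ.1
  rw [← hT] at hψ
  obtain ⟨W, hW, hWψ⟩ := exists_contraction_of_purification hN T ψ hψ
  have hK := norm_exchangeDilation_le_one hM hN hW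
  have hmap : partialTrace (exchangeDilation M N W * trace2 (pureState ψ) *
      (exchangeDilation M N W)ᴴ) = measuredB M ρ := by
    -- After `W` the vector is the coherent measurement of `T`; undoing the isometry recovers `T`,
    -- and only the measurement of `M` remains.
    have h : exchangeDilation M N W * (Matrix.of fun (p : Z × D) (c : C) => ψ (p.1, c, p.2)) =
        measurementDilation (A × B × C) B M * swapThird T := by
      rw [exchangeDilation, Matrix.mul_assoc, Matrix.mul_assoc, hWψ,
        ← Matrix.mul_assoc _ _ (swapThird T), measurementIsometry_isometry hN, Matrix.one_mul]
    rw [trace2_pureState, partialTrace_conj_mul_conjTranspose, reshape_mul_conjTranspose, h,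
      partialTrace_measurementDilation hM, hT]
  refine iSup₂_le fun τ hτ => iSup₂_le fun σ hσ => iSup₂_le fun r hr => ?_
  rw [EReal.le_sub_iff_add_le (Or.inl (EReal.coe_ne_bot _)) (Or.inl (EReal.coe_ne_top _)),
    ← EReal.coe_add]
  refine le_iSup₂_of_le (partialTrace (exchangeDilation M N W * τ * (exchangeDilation M N W)ᴴ))
    ⟨hτ.1.partialTrace_conj hK, ?_⟩ ?_
  · rw [← hmap]
    exact (purifiedDist_partialTrace_le hK hω hτ.1).trans hτ.2
  · have hσ' := hσ.partialTrace_conj (norm_regroupB_le_one hW)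
    refine le_iSup₂_of_le _ hσ' (le_iSup₂_of_le (r + incompatibility M N) ?_ le_rfl)
    refine (partialTrace_conj_mono _ hr).trans ?_
    rw [Matrix.mul_smul, Matrix.smul_mul, partialTrace_smul]
    refine (smul_mono_right (by positivity) (partialTrace_exchangeDilation_le M N
      (overlap_nonneg M N) (norm_sqrt_mul_sqrt_sq_le_overlap M N) W hσ.1)).trans ?_
    rw [smul_smul, neg_add, Real.rpow_add (by norm_num)]
    exact smul_mono_left (mul_le_mul_of_nonneg_left (overlap_le_rpow_neg_incompatibility M N)
      (by positivity)) (PosSemidef.one.kronecker hσ'.1)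

end Channel

/-! ### Finiteness of the smooth min-entropy -/

section Finiteness

variable {A B : Type*} [Fintype A] [DecidableEq A] [Fintype B] [DecidableEq B]

theorem smoothMinEntropy_ne_bot {ρ : Matrix (A × B) (A × B) ℂ} (hρ : IsState ρ) [Nonempty B]
    {ε : ℝ} (hε : 0 ≤ ε) : smoothMinEntropy ε ρ ≠ ⊥ := by
  have hB : (0 : ℝ) < Fintype.card B := by exact_mod_cast Fintype.card_pos
  -- The witness is the maximally mixed state with `ρ ≤ ‖ρ‖ 1`; the added `1` keeps the argument of
  -- the logarithm positive.
  have hc : 0 < (‖ρ‖ + 1) * Fintype.card B := by positivity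
  set σ : Matrix B B ℂ := (Fintype.card B : ℝ)⁻¹ • 1 with hσ
  have hσ' : IsState σ := by
    refine ⟨PosSemidef.one.smul (by positivity), ?_⟩
    rw [hσ, trace_smul, trace_one]
    simp
  refine ne_bot_of_le_ne_bot (EReal.coe_ne_bot (-Real.logb 2 ((‖ρ‖ + 1) * Fintype.card B))) ?_
  refine le_iSup₂_of_le ρ ⟨hρ, by rwa [purifiedDist_self hρ]⟩ (le_iSup₂_of_le σ hσ'
    (le_iSup₂_of_le _ ?_ le_rfl))
  rw [neg_neg, Real.rpow_logb (by norm_num) (by norm_num) hc, hσ, kronecker_smul, smul_smul,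
    mul_assoc, mul_inv_cancel₀ hB.ne', mul_one, one_kronecker_one]
  have h1 : ρ ≤ algebraMap ℝ _ ‖ρ‖ :=
    IsSelfAdjoint.le_algebraMap_norm_self (show IsSelfAdjoint ρ from hρ.1.isHermitian)
  rw [Algebra.algebraMap_eq_smul_one] at h1
  exact h1.trans (smul_mono_left (by linarith) PosSemidef.one)

/-- A state `τ` in the `ε`-ball has `√(tr τ) ≥ √(1 - ε²) - √(1 - tr ρ) = δ > 0`. The trace of `τ ≤
2^(-r) 1 ⊗ σ` then bounds `2^r` by `|A| / δ²`. -/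
theorem smoothMinEntropy_ne_top {ρ : Matrix (A × B) (A × B) ℂ} (hρ : IsState ρ)
    {ε : ℝ} (hε₀ : 0 ≤ ε) (hε : ε < √ρ.trace.re) : smoothMinEntropy ε ρ ≠ ⊤ := by
  have ht : ε ^ 2 < ρ.trace.re := (Real.lt_sqrt hε₀).mp hε
  have ht1 := hρ.2
  set δ : ℝ := √(1 - ε ^ 2) - √(1 - ρ.trace.re) with hδ
  have hδ₀ : 0 < δ := sub_pos.mpr (Real.sqrt_lt_sqrt (by linarith) (by linarith))
  refine ne_top_of_le_ne_top (EReal.coe_ne_top (Real.logb 2 (Fintype.card A / δ ^ 2))) ?_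
  refine iSup₂_le fun τ hτ => iSup₂_le fun σ hσ => iSup₂_le fun r hr => ?_
  rw [EReal.coe_le_coe_iff]
  have h1 : 1 - fidelity ρ τ ^ 2 ≤ ε ^ 2 := (Real.sqrt_le_left hε₀).mp hτ.2
  have h2 : √(1 - ε ^ 2) ≤ fidelity ρ τ :=
    Real.sqrt_le_iff.mpr ⟨fidelity_nonneg ρ τ, by linarith⟩
  have h3 := fidelity_le_sqrt_add_sqrt hρ hτ.1
  have h4 : δ ≤ √τ.trace.re := by rw [hδ]; linarith
  have h5 : δ ^ 2 ≤ τ.trace.re := (Real.le_sqrt' hδ₀).mp h4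
  have h6 : τ.trace.re ≤ 2 ^ (-r) * Fintype.card A := by
    refine (re_trace_le_re_trace hr).trans ?_
    rw [trace_smul, trace_kronecker, trace_one, Complex.smul_re, smul_eq_mul,
      ← Complex.ofReal_natCast, Complex.re_ofReal_mul]
    have := hσ.2
    have hA : (0 : ℝ) ≤ Fintype.card A := by positivity
    have : (Fintype.card A : ℝ) * σ.trace.re ≤ Fintype.card A := by nlinarith
    gcongr
  have hr0 : (0 : ℝ) < 2 ^ r := by positivity
  have h7 : δ ^ 2 * 2 ^ r ≤ Fintype.card A := by
    rw [Real.rpow_neg (by norm_num)] at h6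
    calc δ ^ 2 * 2 ^ r ≤ ((2 ^ r)⁻¹ * Fintype.card A) * 2 ^ r := by gcongr; exact h5.trans h6
      _ = _ := by field_simp
  have h8 : (2 : ℝ) ^ r ≤ Fintype.card A / δ ^ 2 := by
    rw [le_div_iff₀ (by positivity)]; linarith
  exact (Real.le_logb_iff_rpow_le (by norm_num) (hr0.trans_le h8)).mpr h8

end Finiteness

end SmoothEntropy

theorem theorem1 {A B C X Z : Type*}
    [Fintype A] [DecidableEq A] [Fintype B] [DecidableEq B] [Fintype C] [DecidableEq C]
    [Fintype X] [DecidableEq X] [Fintype Z] [DecidableEq Z]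
    (ρ : Matrix (A × B × C) (A × B × C) ℂ) (hρ : SmoothEntropy.IsState ρ)
    (M : X → Matrix A A ℂ) (hM : SmoothEntropy.IsPOVM M)
    (N : Z → Matrix A A ℂ) (hN : SmoothEntropy.IsPOVM N)
    (ε : ℝ) (hε : 0 ≤ ε) :
    (ε < √ρ.trace.re →
      (SmoothEntropy.incompatibility M N : EReal) ≤
        SmoothEntropy.smoothMinEntropy ε (SmoothEntropy.measuredB M ρ) +
          SmoothEntropy.smoothMaxEntropy ε (SmoothEntropy.measuredC N ρ)) ∧
    (SmoothEntropy.incompatibility M N : EReal) -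
        SmoothEntropy.smoothMaxEntropy ε (SmoothEntropy.measuredC N ρ) ≤
      SmoothEntropy.smoothMinEntropy ε (SmoothEntropy.measuredB M ρ) := by
  have hsub : (SmoothEntropy.incompatibility M N : EReal) -
      SmoothEntropy.smoothMaxEntropy ε (SmoothEntropy.measuredC N ρ) ≤
      SmoothEntropy.smoothMinEntropy ε (SmoothEntropy.measuredB M ρ) := by
    have h1 : -(SmoothEntropy.smoothMinEntropy ε (SmoothEntropy.measuredB M ρ) -
        (SmoothEntropy.incompatibility M N : EReal)) ≤
        SmoothEntropy.smoothMaxEntropy ε (SmoothEntropy.measuredC N ρ) :=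
      le_iInf fun n => le_iInf₂ fun ψ hψ => EReal.neg_le_neg_iff.mpr
        (SmoothEntropy.smoothMinEntropy_purification_le hρ hM hN ε ψ hψ)
    have h2 := EReal.neg_le.mp h1
    rw [EReal.le_sub_iff_add_le (Or.inl (EReal.coe_ne_bot _)) (Or.inl (EReal.coe_ne_top _))] at h2
    rwa [sub_eq_add_neg, add_comm]
  refine ⟨fun hlt => ?_, hsub⟩
  have hstate := SmoothEntropy.isState_measuredB hM hρ
  have htr := SmoothEntropy.trace_measuredB hM ρ
  -- For empty `B` the trace of `ρ` is zero and no `ε ≥ 0` lies below its root.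
  have hne : Nonempty B := by
    by_contra hB
    rw [not_nonempty_iff] at hB
    have : ρ.trace = 0 := by simp [Matrix.trace]
    rw [this, Complex.zero_re, Real.sqrt_zero] at hlt
    exact absurd hlt (not_lt.mpr hε)
  -- Moving the max-entropy across the inequality in `EReal` is justified by finiteness of the
  -- min-entropy of `XB`.
  exact (EReal.sub_le_iff_le_add
    (Or.inr (SmoothEntropy.smoothMinEntropy_ne_top hstate hε (by rwa [htr])))
    (Or.inr (SmoothEntropy.smoothMinEntropy_ne_bot hstate hε))).mp hsub
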